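/- Let $p\ge 0$ and let $(Y,X^{(1)},\dots,X^{(p)})$ be a vector of square integrable real random variables with $\operatorname{Var}(Y)>0$. Let $(Y_i,X_i^{(1)},\dots,X_i^{(p)})_{i\ge 1}$ be independent copies of this vector. **Population quantities.** Assume that $\mathbf 1,X^{(1)},\dots,X^{(p)}$ are linearly independent in $\mathbb L^2$, that is, no $\gamma\neq 0$ in $\mathbb R^{p+1}$ satisfies $\gamma_0+\gamma_1X^{(1)}+\cdots+\gamma_pX^{(p)}=0$ almost surely. Let $\mathrm{Proj}_V(Y)=\alpha_0+\alpha_1X^{(1)}+\cdots+\alpha_pX^{(p)}$ be the orthogonal projection in $\mathbb L^2$ of $Y$ onto the space $V$ generated by $\mathbf 1,X^{(1)},\dots,X^{(p)}$, and let $\varepsilon=Y-\mathrm{Proj}_V(Y)$. For $1\le k\le p$ let $e^{(k)}=X^{(k)}-\mathrm{Proj}_W(X^{(k)})$, where $W$ is the subspace of $\mathbb L^2$ generated by $\mathbf 1$ and $Y$. Put $$\theta_k=\frac{\operatorname{Cov}(Y,X^{(k)})}{\operatorname{Var}(Y)},\qquad R^2=\frac{\operatorname{Var}(\mathrm{Proj}_V(Y))}{\operatorname{Var}(Y)}.$$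 Assume also that, for all $j\in\{1,\dots,p\}$, $$\mathbb E\big((X^{(j)}-\mathbb E X^{(j)})^2\varepsilon^2\big)<\infty\quad\text{and}\quad \mathbb E\big((Y-\mathbb E Y)^2(e^{(j)})^2\big)<\infty .$$ **Matrices.** Let $\mathbf M_0=(\operatorname{Cov}(X^{(j)},X^{(\ell)}))_{1\le j,\ell\le p}$, which is invertible. Let $\mathbf A$ and $\mathbf B$ be the symmetric $2p\times 2p$ matrices such that, for $1\le j,k\le p$, $$\mathbf A_{j,k}=\mathbb E\big((X^{(j)}-\mathbb EX^{(j)})(X^{(k)}-\mathbb EX^{(k)})\varepsilon^2\big),\qquad \mathbf A_{p+j,p+k}=\mathbb E\big((Y-\mathbb EY)^2e^{(j)}e^{(k)}\big),$$ $$\mathbf A_{j,p+k}=\mathbb E\big((X^{(j)}-\mathbb EX^{(j)})(Y-\mathbb EY)\,\varepsilon\, e^{(k)}\big),$$ $$\mathbf B_{j,k}=(\mathbf M_0^{-1})_{j,k},\qquad \mathbf B_{p+j,p+k}=\operatorname{Var}(Y)^{-1}\delta_{j,k},\qquad \mathbf B_{j,p+k}=0 .$$ **Estimator.** For $\mathbf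 z\in\mathbb R^n$ let $\operatorname{Var}_n(\mathbf z)=\frac1n\sum_{i=1}^n(z_i-\bar z)^2$ with $\bar z=\frac1n\sum_{i=1}^n z_i$. Let $\mathbf Y=(Y_1,\dots,Y_n)^t$ and $\mathbb X^{(j)}=(X^{(j)}_1,\dots,X^{(j)}_n)^t$, and let $\Pi$ be the Euclidean orthogonal projection of $\mathbb R^n$ onto the subspace generated by $(1,\dots,1)^t,\mathbb X^{(1)},\dots,\mathbb X^{(p)}$. Put $$\widehat R^2=\frac{\operatorname{Var}_n(\Pi(\mathbf Y))}{\operatorname{Var}_n(\mathbf Y)},$$ with the convention $\widehat R^2=0$ when $\operatorname{Var}_n(\mathbf Y)=0$. **Proposition.** Let $$V=(\theta_1,\dots,\theta_p,\alpha_1,\dots,\alpha_p)\,\mathbf B\mathbf A\mathbf B\,(\theta_1,\dots,\theta_p,\alpha_1,\dots,\alpha_p)^t .$$ Then $V\ge 0$ and, as $n\to\infty$, $\sqrt n\,(\widehat R^2-R^2)$ converges in law to $\mathcal N(0,V)$, where $\mathcal N(0,0)$ is the Dirac mass at $0$. -/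

import Mathlib

open MeasureTheory ProbabilityTheory Filter
open scoped Matrix

noncomputable section

namespace MultCorr

/-! ### Population quantities, for square integrable random variables -/

section Population

variable {Ω : Type*} [MeasurableSpace Ω] {P : Measure Ω} [IsProbabilityMeasure P] {p : ℕ}

/-- The family `1, X⁽¹⁾, …, X⁽ᵖ⁾` of elements of `L²(P)`; index `0` is the constant variable `1` and
index `j.succ` is the explanatory variable `X j`. -/
def withOne (X : Fin p → Lp ℝ 2 P) : Fin (p + 1) → Lp ℝ 2 P :=
  Matrix.vecCons (Lp.const 2 P (1 : ℝ)) X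

/-- The subspace of `L²(P)` generated by `1, X⁽¹⁾, …, X⁽ᵖ⁾`. -/
abbrev affSpan (X : Fin p → Lp ℝ 2 P) : Submodule ℝ (Lp ℝ 2 P) :=
  Submodule.span ℝ (Set.range (withOne X))

instance (X : Fin p → Lp ℝ 2 P) : FiniteDimensional ℝ (affSpan X) :=
  FiniteDimensional.span_of_finite ℝ (Set.finite_range _)

instance (X : Fin p → Lp ℝ 2 P) : (affSpan X).HasOrthogonalProjection :=
  inferInstance

/-- The best linear predictor of `Y` given `X`: the orthogonal projection, in `L²(P)`, of `Y` onto
the subspace generated by `1, X⁽¹⁾, …, X⁽ᵖ⁾`. -/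
def linProj (X : Fin p → Lp ℝ 2 P) (Y : Lp ℝ 2 P) : Lp ℝ 2 P :=
  (affSpan X).starProjection Y

/-- The residual `Y - Proj(Y)` of the best linear predictor. -/
def linRes (X : Fin p → Lp ℝ 2 P) (Y : Lp ℝ 2 P) : Lp ℝ 2 P :=
  Y - linProj X Y

/-- The residual `ε = Y - Proj_V(Y)`, with `V` generated by `1, X⁽¹⁾, …, X⁽ᵖ⁾`. -/
def eps (X : Fin p → Lp ℝ 2 P) (Y : Lp ℝ 2 P) : Lp ℝ 2 P :=
  linRes X Y

/-- The residual `e⁽ᵏ⁾ = X⁽ᵏ⁾ - Proj_W(X⁽ᵏ⁾)`, with `W` generated by `1` and `Y`. -/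
def revRes (X : Fin p → Lp ℝ 2 P) (Y : Lp ℝ 2 P) (k : Fin p) : Lp ℝ 2 P :=
  linRes (fun _ : Fin 1 => Y) (X k)

/-- The population coefficient `R² = Var(Proj_V(Y)) / Var(Y)`. -/
def R2 (X : Fin p → Lp ℝ 2 P) (Y : Lp ℝ 2 P) : ℝ :=
  Var[linProj X Y; P] / Var[Y; P]

/-- The coefficients `α₁, …, αₚ` of the unique decomposition
`Proj_V(Y) = α₀ + α₁ X⁽¹⁾ + ⋯ + αₚ X⁽ᵖ⁾` in the linearly independent family `1, X⁽¹⁾, …, X⁽ᵖ⁾`. -/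
def alpha (X : Fin p → Lp ℝ 2 P) (hli : LinearIndependent ℝ (withOne X)) (Y : Lp ℝ 2 P)
    (j : Fin p) : ℝ :=
  hli.repr ((affSpan X).orthogonalProjectionOnto Y) j.succ

/-- `θₖ = Cov(Y, X⁽ᵏ⁾) / Var(Y)`. -/
def theta (X : Fin p → Lp ℝ 2 P) (Y : Lp ℝ 2 P) (k : Fin p) : ℝ :=
  cov[Y, X k; P] / Var[Y; P]

/-- The covariance matrix `M₀` of `(X⁽¹⁾, …, X⁽ᵖ⁾)`. -/
def covMat (X : Fin p → Lp ℝ 2 P) : Matrix (Fin p) (Fin p) ℝ :=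
  Matrix.of fun j l => cov[X j, X l; P]

/-- Upper left block of `A`: `E((X⁽ʲ⁾ - E X⁽ʲ⁾)(X⁽ᵏ⁾ - E X⁽ᵏ⁾) ε²)`. -/
def blockXX (X : Fin p → Lp ℝ 2 P) (Y : Lp ℝ 2 P) : Matrix (Fin p) (Fin p) ℝ :=
  Matrix.of fun j k =>
    ∫ ω, (X j ω - ∫ ω', X j ω' ∂P) * (X k ω - ∫ ω', X k ω' ∂P) * (eps X Y ω) ^ 2 ∂P

/-- Lower right block of `A`: `E((Y - E Y)² e⁽ʲ⁾ e⁽ᵏ⁾)`. -/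
def blockYY (X : Fin p → Lp ℝ 2 P) (Y : Lp ℝ 2 P) : Matrix (Fin p) (Fin p) ℝ :=
  Matrix.of fun j k =>
    ∫ ω, (Y ω - ∫ ω', Y ω' ∂P) ^ 2 * revRes X Y j ω * revRes X Y k ω ∂P

/-- Upper right block of `A`: `E((X⁽ʲ⁾ - E X⁽ʲ⁾)(Y - E Y) ε e⁽ᵏ⁾)`. -/
def blockXY (X : Fin p → Lp ℝ 2 P) (Y : Lp ℝ 2 P) : Matrix (Fin p) (Fin p) ℝ :=
  Matrix.of fun j k =>
    ∫ ω, (X j ω - ∫ ω', X j ω' ∂P) * (Y ω - ∫ ω', Y ω' ∂P) * eps X Y ω * revRes X Y k ω ∂P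

/-- The symmetric `2p × 2p` matrix `A`; the indices `1, …, p` and `p + 1, …, 2p` are the two copies
of `Fin p` in `Fin p ⊕ Fin p`. -/
def matA (X : Fin p → Lp ℝ 2 P) (Y : Lp ℝ 2 P) : Matrix (Fin p ⊕ Fin p) (Fin p ⊕ Fin p) ℝ :=
  Matrix.fromBlocks (blockXX X Y) (blockXY X Y) (blockXY X Y)ᵀ (blockYY X Y)

/-- The symmetric `2p × 2p` matrix `B`, block diagonal with blocks `M₀⁻¹` and `Var(Y)⁻¹ I`. -/
def matB (X : Fin p → Lp ℝ 2 P) (Y : Lp ℝ 2 P) : Matrix (Fin p ⊕ Fin p) (Fin p ⊕ Fin p) ℝ :=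
  Matrix.fromBlocks (covMat X)⁻¹ 0 0 ((Var[Y; P])⁻¹ • (1 : Matrix (Fin p) (Fin p) ℝ))

/-- The limiting variance `V = (θ, α) B A B (θ, α)ᵗ`. -/
def limVar (X : Fin p → Lp ℝ 2 P) (hli : LinearIndependent ℝ (withOne X)) (Y : Lp ℝ 2 P) : ℝ :=
  Sum.elim (theta X Y) (alpha X hli Y) ⬝ᵥ
    ((matB X Y * matA X Y * matB X Y) *ᵥ Sum.elim (theta X Y) (alpha X hli Y))

end Population

/-! ### Empirical quantities -/

section Empirical

variable {n p : ℕ}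

/-- Empirical variance `Varₙ(z) = (1/n) ∑ᵢ (zᵢ - z̄)²`, with `z̄ = (1/n) ∑ᵢ zᵢ`. -/
def empVar (z : EuclideanSpace ℝ (Fin n)) : ℝ :=
  (1 / (n : ℝ)) * ∑ i, (z i - (1 / (n : ℝ)) * ∑ i', z i') ^ 2

/-- The subspace of Euclidean space `ℝⁿ` generated by `(1, …, 1)` and the `p` columns of the
`n × p` array `x`. -/
abbrev empSpan (x : Fin n → Fin p → ℝ) : Submodule ℝ (EuclideanSpace ℝ (Fin n)) :=
  Submodule.span ℝ (Set.range (Matrix.vecCons (WithLp.toLp 2 (fun _ : Fin n => (1 : ℝ)))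
    (fun j : Fin p => WithLp.toLp 2 (fun i : Fin n => x i j))))

/-- The empirical coefficient `R̂² = Varₙ(Π(y)) / Varₙ(y)`, with `Π` the orthogonal projection onto
the subspace generated by `(1, …, 1)` and the columns of `x`. -/
def empR2 (x : Fin n → Fin p → ℝ) (y : Fin n → ℝ) : ℝ :=
  empVar ((empSpan x).starProjection (WithLp.toLp 2 y)) / empVar (WithLp.toLp 2 y)

end Empirical

end MultCorr

end

/-! Both coefficients are scalar products. Expanding the variance of the projection and using the
normal equations `M₀ α = Cov(X, Y)` gives `R² = θ · α` (`R2_eq`). When the empirical covariance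
matrix is invertible, the empirical coefficient is likewise `θ̂ · α̂`, with `α̂` the least squares
slopes and `θ̂` the empirical counterpart of `θ` (`empR2_eq`). Hence the exact identity `R̂² - R² =
θ · (α̂ - α) + α̂ · (θ̂ - θ)`, in which `α̂ - α` is the inverse empirical covariance matrix applied
to the empirical covariances of `X` with `ε`, and `θ̂ - θ` is the vector of empirical covariances of
`Y` with the `e⁽ᵏ⁾`, divided by the empirical variance of `Y` (`empR2_sub_eq`). No delta method is
needed.

The error is thus a sum of empirical covariances of centered, uncorrelated pairs with random
weights. By the law of large numbers the weights converge almost surely to `B (θ, α)`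
(`ae_tendsto_empScoreWeight`). Replacing them by their limits, and each empirical covariance by the
mean of the products, costs a null sequence times a `√n`-normalized mean, which Chebyshev bounds in
probability. Slutsky's lemma and the central limit theorem conclude
(`tendstoInDistribution_sum_mul_empCov`). The moment hypotheses say exactly that the products are
square integrable. Their Gram matrix is `A`, so the limiting variance is a second moment equal to
`V` (`limVar_eq_integral_sq`), which also shows `V ≥ 0`. -/

namespace MultCorr

/-! ### Symmetry of `M₀` and `B`. -/

section Symmetry

variable {Ω : Type*} [MeasurableSpace Ω] {P : Measure Ω} {p : ℕ}

lemma covMat_isSymm (X : Fin p → Lp ℝ 2 P) : (covMat X).IsSymm :=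
  Matrix.IsSymm.ext fun i j => by simp only [covMat, Matrix.of_apply]; rw [covariance_comm]

lemma matB_isSymm (X : Fin p → Lp ℝ 2 P) (Y : Lp ℝ 2 P) : (matB X Y)ᵀ = matB X Y := by
  rw [matB, Matrix.fromBlocks_transpose, Matrix.transpose_nonsing_inv, (covMat_isSymm X).eq]
  simp

end Symmetry

/-! ### Population regression: normal equations, `R²`, and `V` as a second moment. -/

section PopulationLemmas

variable {Ω : Type*} [MeasurableSpace Ω] {P : Measure Ω} [IsProbabilityMeasure P] {p : ℕ}

lemma memLp_sub_integral (Z : Lp ℝ 2 P) : MemLp (fun ω => Z ω - ∫ ω', Z ω' ∂P) 2 P :=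
  (Lp.memLp Z).sub (memLp_const _)

lemma integral_sub_integral (Z : Lp ℝ 2 P) : ∫ ω, (Z ω - ∫ ω', Z ω' ∂P) ∂P = 0 := by
  rw [integral_sub ((Lp.memLp Z).integrable one_le_two) (integrable_const _)]
  simp

lemma integral_mul_linRes_of_mem (X : Fin p → Lp ℝ 2 P) (Z : Lp ℝ 2 P) {w : Lp ℝ 2 P}
    (hw : w ∈ affSpan X) : ∫ ω, w ω * linRes X Z ω ∂P = 0 := by
  have h := Submodule.starProjection_inner_eq_zero (K := affSpan X) Z w hw
  rw [L2.inner_def] at h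
  exact h

lemma integral_linRes (X : Fin p → Lp ℝ 2 P) (Z : Lp ℝ 2 P) :
    ∫ ω, linRes X Z ω ∂P = 0 := by
  have h := integral_mul_linRes_of_mem X Z (w := withOne X 0)
    (Submodule.subset_span (Set.mem_range_self _))
  rw [← h]
  refine integral_congr_ae ?_
  filter_upwards [Lp.coeFn_const 2 P (1 : ℝ)] with ω hω
  simp only [withOne, Matrix.cons_val_zero, hω, Function.const_apply, one_mul]

lemma integral_centered_mul_linRes (X : Fin p → Lp ℝ 2 P) (Z : Lp ℝ 2 P) (k : Fin p) :
    ∫ ω, (X k ω - ∫ ω', X k ω' ∂P) * linRes X Z ω ∂P = 0 := by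
  have h := integral_mul_linRes_of_mem X Z (w := withOne X k.succ)
    (Submodule.subset_span (Set.mem_range_self _))
  simp only [withOne, Matrix.cons_val_succ] at h
  have hi : Integrable (fun ω => X k ω * linRes X Z ω) P :=
    (Lp.memLp (X k)).integrable_mul (Lp.memLp (linRes X Z))
  simp only [sub_mul]
  rw [integral_sub hi (((Lp.memLp (linRes X Z)).integrable one_le_two).const_mul _), h,
    integral_const_mul, integral_linRes]
  simp

lemma sum_smul_withOne_ae_eq (X : Fin p → Lp ℝ 2 P) (a : Fin (p + 1) → ℝ) :
    ⇑(∑ i, a i • withOne X i) =ᵐ[P] fun ω => a 0 + ∑ j : Fin p, a j.succ * X j ω := by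
  have h2 : ∀ᵐ ω ∂P, ∀ i, (a i • withOne X i) ω = a i * withOne X i ω :=
    ae_all_iff.2 fun i => by
      filter_upwards [Lp.coeFn_smul (a i) (withOne X i)] with ω hω
      simp [hω]
  filter_upwards [Lp.coeFn_finsetSum Finset.univ fun i => a i • withOne X i, h2,
    Lp.coeFn_const 2 P (1 : ℝ)] with ω h h2 h3
  rw [h, Finset.sum_apply, Fin.sum_univ_succ]
  simp only [h2]
  simp only [withOne, Matrix.cons_val_zero, Matrix.cons_val_succ, h3, Function.const_apply, mul_one]

/-- Since constants lie in the span, the residual has mean zero. This determines the intercept `a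
0`, and eliminating it centers every variable. -/
lemma linRes_ae_eq (X : Fin p → Lp ℝ 2 P) (Z : Lp ℝ 2 P) {a : Fin (p + 1) → ℝ}
    (ha : ∑ i, a i • withOne X i = linProj X Z) :
    linRes X Z =ᵐ[P] fun ω => (Z ω - ∫ ω', Z ω' ∂P) -
      ∑ j : Fin p, a j.succ * (X j ω - ∫ ω', X j ω' ∂P) := by
  have h1 : linRes X Z =ᵐ[P] fun ω => Z ω - (a 0 + ∑ j : Fin p, a j.succ * X j ω) := by
    filter_upwards [Lp.coeFn_sub Z (linProj X Z), sum_smul_withOne_ae_eq X a] with ω h h2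
    rw [linRes, h, Pi.sub_apply, ← ha, h2]
  have hi : ∀ j, Integrable (X j) P := fun j => (Lp.memLp (X j)).integrable one_le_two
  have h0 : ∫ ω, Z ω ∂P = a 0 + ∑ j : Fin p, a j.succ * ∫ ω, X j ω ∂P := by
    have h := integral_linRes X Z
    have hs : Integrable (fun ω => a 0 + ∑ j : Fin p, a j.succ * X j ω) P :=
      (integrable_const _).add (integrable_finsetSum _ fun j _ => (hi j).const_mul _)
    rw [integral_congr_ae h1, integral_sub ((Lp.memLp Z).integrable one_le_two) hs,
      integral_add (integrable_const _) (integrable_finsetSum _ fun j _ => (hi j).const_mul _),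
      integral_finsetSum _ fun j _ => (hi j).const_mul _] at h
    simp only [integral_const_mul, integral_const, probReal_univ, one_smul] at h
    linarith
  filter_upwards [h1] with ω h
  rw [h, h0]
  simp only [mul_sub, Finset.sum_sub_distrib]
  ring

/-- The normal equations: expand the orthogonality of the residual to the centered `X k`. -/
lemma cov_eq_sum_of_linProj_eq (X : Fin p → Lp ℝ 2 P) (Z : Lp ℝ 2 P) {a : Fin (p + 1) → ℝ}
    (ha : ∑ i, a i • withOne X i = linProj X Z) (k : Fin p) :
    cov[X k, Z; P] = ∑ j : Fin p, cov[X k, X j; P] * a j.succ := by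
  have h := integral_centered_mul_linRes X Z k
  have hc : (fun ω => (X k ω - ∫ ω', X k ω' ∂P) * linRes X Z ω) =ᵐ[P] fun ω =>
      (X k ω - ∫ ω', X k ω' ∂P) * (Z ω - ∫ ω', Z ω' ∂P) - ∑ j : Fin p,
        ((X k ω - ∫ ω', X k ω' ∂P) * (X j ω - ∫ ω', X j ω' ∂P)) * a j.succ := by
    filter_upwards [linRes_ae_eq X Z ha] with ω hω
    rw [hω, mul_sub, Finset.mul_sum]
    congr 1
    exact Finset.sum_congr rfl fun j _ => by ring
  have hi : ∀ j, Integrable (fun ω => ((X k ω - ∫ ω', X k ω' ∂P) *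
      (X j ω - ∫ ω', X j ω' ∂P)) * a j.succ) P := fun j =>
    ((memLp_sub_integral (X k)).integrable_mul (memLp_sub_integral (X j))).mul_const _
  have hZ : Integrable (fun ω => (X k ω - ∫ ω', X k ω' ∂P) * (Z ω - ∫ ω', Z ω' ∂P)) P :=
    (memLp_sub_integral (X k)).integrable_mul (memLp_sub_integral Z)
  rw [integral_congr_ae hc, integral_sub hZ (integrable_finsetSum _ fun j _ => hi j),
    integral_finsetSum _ fun j _ => hi j] at h
  simp only [integral_mul_const] at h
  exact sub_eq_zero.1 h

variable {X : Fin p → Lp ℝ 2 P} {Y : Lp ℝ 2 P}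

lemma exists_alpha (hli : LinearIndependent ℝ (withOne X)) (Y : Lp ℝ 2 P) :
    ∃ a : Fin (p + 1) → ℝ, ∑ i, a i • withOne X i = linProj X Y ∧
      ∀ j : Fin p, a j.succ = alpha X hli Y j := by
  refine ⟨fun i => hli.repr ((affSpan X).orthogonalProjectionOnto Y) i, ?_, fun j => rfl⟩
  have h := hli.linearCombination_repr ((affSpan X).orthogonalProjectionOnto Y)
  rw [Finsupp.linearCombination_apply, Finsupp.sum_fintype _ _ (by simp)] at h
  exact h

lemma eps_ae_eq (hli : LinearIndependent ℝ (withOne X)) (Y : Lp ℝ 2 P) :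
    eps X Y =ᵐ[P] fun ω => (Y ω - ∫ ω', Y ω' ∂P) -
      ∑ j : Fin p, alpha X hli Y j * (X j ω - ∫ ω', X j ω' ∂P) := by
  obtain ⟨a, ha, h⟩ := exists_alpha hli Y
  simpa only [h] using! linRes_ae_eq X Y ha

lemma covMat_mulVec_alpha (hli : LinearIndependent ℝ (withOne X)) (Y : Lp ℝ 2 P) :
    covMat X *ᵥ alpha X hli Y = fun k => cov[X k, Y; P] := by
  obtain ⟨a, ha, h⟩ := exists_alpha hli Y
  ext k
  rw [cov_eq_sum_of_linProj_eq X Y ha k]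
  simp only [h, Matrix.mulVec, dotProduct, covMat, Matrix.of_apply]

/-- Some coefficients exist because the projection lies in the span of `1, Y`. The single normal
equation reads `Cov = Var(Y) * a`, so nonzero variance forces the slope to be `θₖ`. -/
lemma revRes_ae_eq (X : Fin p → Lp ℝ 2 P) (hvar : Var[Y; P] ≠ 0) (k : Fin p) :
    revRes X Y k =ᵐ[P] fun ω => (X k ω - ∫ ω', X k ω' ∂P) -
      theta X Y k * (Y ω - ∫ ω', Y ω' ∂P) := by
  obtain ⟨a, ha⟩ := (Submodule.mem_span_range_iff_exists_fun ℝ).1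
    (Submodule.starProjection_apply_mem (affSpan (fun _ : Fin 1 => Y)) (X k))
  have h1 := linRes_ae_eq (fun _ : Fin 1 => Y) (X k) ha
  have h2 := cov_eq_sum_of_linProj_eq (fun _ : Fin 1 => Y) (X k) ha 0
  simp only [Finset.univ_unique, Finset.sum_singleton] at h1 h2
  rw [covariance_self (Lp.aestronglyMeasurable Y).aemeasurable] at h2
  have h3 : theta X Y k = a (Fin.succ default) := by
    rw [theta, h2]; field_simp
  rw [h3]
  exact h1

lemma variance_sum_mul (X : Fin p → Lp ℝ 2 P) (a : Fin p → ℝ) :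
    Var[fun ω => ∑ j, a j * X j ω; P] = a ⬝ᵥ (covMat X *ᵥ a) := by
  have h : (fun ω => ∑ j, a j * X j ω) = ∑ j, fun ω => a j * X j ω := by
    ext ω; simp
  rw [h, variance_sum' fun j _ => (Lp.memLp (X j)).const_mul (a j)]
  simp only [dotProduct, Matrix.mulVec, Finset.mul_sum, covMat, Matrix.of_apply,
    covariance_const_mul_left, covariance_const_mul_right]
  exact Finset.sum_congr rfl fun i _ => Finset.sum_congr rfl fun j _ => by ring

/-- A kernel vector `v` gives a combination of the `X j` with zero variance, hence almost surely
equal to a constant `c`. The coefficients `(-c, v)` would then be a linear relation in `1, X`. -/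
lemma isUnit_det_covMat (hli : LinearIndependent ℝ (withOne X)) : IsUnit (covMat X).det := by
  rw [isUnit_iff_ne_zero]
  intro h0
  obtain ⟨v, hv, hv0⟩ := Matrix.exists_mulVec_eq_zero_iff.2 h0
  have hvar := variance_sum_mul X v
  rw [hv0, dotProduct_zero] at hvar
  have hL : MemLp (fun ω => ∑ j, v j * X j ω) 2 P :=
    memLp_finsetSum _ fun j _ => (Lp.memLp (X j)).const_mul (v j)
  have hc := ae_eq_integral_of_variance_eq_zero hL hvar
  set c := ∫ ω, (∑ j, v j * X j ω) ∂P
  let a : Fin (p + 1) → ℝ := Fin.cons (-c) v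
  have hz : ∑ i, a i • withOne X i = 0 := by
    refine Lp.ext ?_
    filter_upwards [sum_smul_withOne_ae_eq X a, hc, Lp.coeFn_zero ℝ 2 P] with ω h1 h2 h3
    rw [h1, h3]
    simp [a, h2]
  have := Fintype.linearIndependent_iff.1 hli a hz
  exact hv (funext fun j => by simpa [a] using this j.succ)

lemma inv_covMat_mulVec_cov (hli : LinearIndependent ℝ (withOne X)) (Y : Lp ℝ 2 P) :
    (covMat X)⁻¹ *ᵥ (fun k => cov[X k, Y; P]) = alpha X hli Y := by
  rw [← covMat_mulVec_alpha hli Y, Matrix.mulVec_mulVec,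
    Matrix.nonsing_inv_mul _ (isUnit_det_covMat hli), Matrix.one_mulVec]

lemma R2_eq (hli : LinearIndependent ℝ (withOne X)) (Y : Lp ℝ 2 P) :
    R2 X Y = theta X Y ⬝ᵥ alpha X hli Y := by
  obtain ⟨a, ha, h⟩ := exists_alpha hli Y
  have h1 := sum_smul_withOne_ae_eq X a
  simp only [h, ha] at h1
  rw [R2, variance_congr h1, variance_const_add (by
      exact (memLp_finsetSum _ fun j _ =>
        (Lp.memLp (X j)).const_mul (alpha X hli Y j)).aestronglyMeasurable),
    variance_sum_mul, covMat_mulVec_alpha, dotProduct_comm]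
  simp only [dotProduct, theta, Finset.sum_div]
  exact Finset.sum_congr rfl fun i _ => by rw [covariance_comm]; ring

/-- The family of variables whose Gram matrix is `matA`. -/
noncomputable def scoreVar (X : Fin p → Lp ℝ 2 P) (Y : Lp ℝ 2 P) : Fin p ⊕ Fin p → Ω → ℝ :=
  Sum.elim (fun j ω => (X j ω - ∫ ω', X j ω' ∂P) * eps X Y ω)
    (fun j ω => (Y ω - ∫ ω', Y ω' ∂P) * revRes X Y j ω)

lemma matA_apply (X : Fin p → Lp ℝ 2 P) (Y : Lp ℝ 2 P) (a b : Fin p ⊕ Fin p) :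
    matA X Y a b = ∫ ω, scoreVar X Y a ω * scoreVar X Y b ω ∂P := by
  rcases a with a | a <;> rcases b with b | b <;>
    simp only [matA, Matrix.fromBlocks_apply₁₁, Matrix.fromBlocks_apply₁₂,
      Matrix.fromBlocks_apply₂₁, Matrix.fromBlocks_apply₂₂, Matrix.transpose_apply, blockXX,
      blockXY, blockYY, Matrix.of_apply, scoreVar, Sum.elim_inl, Sum.elim_inr] <;>
    exact integral_congr_ae (.of_forall fun ω => by ring)

/-- The weights of the linear combination of `scoreVar` whose variance is `limVar`. -/
noncomputable def scoreWeight (X : Fin p → Lp ℝ 2 P)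
    (hli : LinearIndependent ℝ (withOne X)) (Y : Lp ℝ 2 P) :
    Fin p ⊕ Fin p → ℝ :=
  Sum.elim ((covMat X)⁻¹ *ᵥ theta X Y) (fun k => alpha X hli Y k / Var[Y; P])

lemma matB_mulVec (hli : LinearIndependent ℝ (withOne X)) (Y : Lp ℝ 2 P) :
    matB X Y *ᵥ Sum.elim (theta X Y) (alpha X hli Y) = scoreWeight X hli Y := by
  rw [matB, Matrix.fromBlocks_mulVec, scoreWeight]
  congr 1
  · simp
  · ext k
    simp [Matrix.smul_mulVec, div_eq_inv_mul]

lemma limVar_eq (hli : LinearIndependent ℝ (withOne X)) (Y : Lp ℝ 2 P) :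
    limVar X hli Y = scoreWeight X hli Y ⬝ᵥ (matA X Y *ᵥ scoreWeight X hli Y) := by
  rw [limVar, ← matB_mulVec hli Y, ← Matrix.mulVec_mulVec, ← Matrix.mulVec_mulVec,
    Matrix.dotProduct_mulVec _ (matB X Y), ← Matrix.mulVec_transpose, matB_isSymm]

/-- `A` is the Gram matrix of `scoreVar`, so the quadratic form is the second moment of a linear
combination. Square integrability allows the expanded square to be integrated term by term. -/
lemma limVar_eq_integral_sq (hli : LinearIndependent ℝ (withOne X)) (Y : Lp ℝ 2 P)
    (hL : ∀ a, MemLp (scoreVar X Y a) 2 P) :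
    limVar X hli Y = ∫ ω, (∑ a, scoreWeight X hli Y a * scoreVar X Y a ω) ^ 2 ∂P := by
  have h : ∀ ω, (∑ a, scoreWeight X hli Y a * scoreVar X Y a ω) ^ 2 =
      ∑ a, ∑ b, scoreWeight X hli Y a * scoreWeight X hli Y b *
        (scoreVar X Y a ω * scoreVar X Y b ω) := fun ω => by
    rw [sq, Finset.sum_mul_sum]
    exact Finset.sum_congr rfl fun a _ => Finset.sum_congr rfl fun b _ => by ring
  have hi : ∀ a b, Integrable (fun ω => scoreWeight X hli Y a * scoreWeight X hli Y b *
        (scoreVar X Y a ω * scoreVar X Y b ω)) P := fun a b =>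
    ((hL a).integrable_mul (hL b)).const_mul _
  simp only [h]
  rw [integral_finsetSum _ fun a _ => integrable_finsetSum _ fun b _ => hi a b, limVar_eq]
  simp only [dotProduct, Matrix.mulVec, Finset.mul_sum]
  refine Finset.sum_congr rfl fun a _ => ?_
  rw [integral_finsetSum _ fun b _ => hi a b]
  refine Finset.sum_congr rfl fun b _ => ?_
  rw [integral_const_mul, matA_apply]
  ring

/-- Both cases are orthogonality of a residual to a centered regressor. In the second the only
regressor is `Y`, with index `0 : Fin 1`. -/
lemma integral_scoreVar (X : Fin p → Lp ℝ 2 P) (Y : Lp ℝ 2 P) (a : Fin p ⊕ Fin p) :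
    ∫ ω, scoreVar X Y a ω ∂P = 0 := by
  rcases a with a | a
  · exact integral_centered_mul_linRes X Y a
  · exact integral_centered_mul_linRes (fun _ : Fin 1 => Y) (X a) 0

lemma memLp_scoreVar
    (hXeps : ∀ j, Integrable (fun ω => (X j ω - ∫ ω', X j ω' ∂P) ^ 2 * (eps X Y ω) ^ 2) P)
    (hYe : ∀ j, Integrable (fun ω => (Y ω - ∫ ω', Y ω' ∂P) ^ 2 * (revRes X Y j ω) ^ 2) P)
    (a : Fin p ⊕ Fin p) : MemLp (scoreVar X Y a) 2 P := by
  rcases a with a | a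
  · refine (memLp_two_iff_integrable_sq ((memLp_sub_integral (X a)).aestronglyMeasurable.mul
      (Lp.aestronglyMeasurable _))).2 ?_
    simpa only [Pi.mul_apply, mul_pow] using hXeps a
  · refine (memLp_two_iff_integrable_sq ((memLp_sub_integral Y).aestronglyMeasurable.mul
      (Lp.aestronglyMeasurable _))).2 ?_
    simpa only [Pi.mul_apply, mul_pow] using hYe a

end PopulationLemmas

/-! ### Empirical covariances, least squares and the exact error expansion. -/

section EmpiricalLemmas

variable {n p : ℕ}

/-- Empirical mean. -/
noncomputable def avg (u : Fin n → ℝ) : ℝ := (1 / (n : ℝ)) * ∑ i, u i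

lemma avg_sub (u v : Fin n → ℝ) : avg (fun i => u i - v i) = avg u - avg v := by
  simp only [avg, Finset.sum_sub_distrib, mul_sub]

lemma avg_const_mul (c : ℝ) (u : Fin n → ℝ) : avg (fun i => c * u i) = c * avg u := by
  simp only [avg, ← Finset.mul_sum]; ring

lemma avg_mul_const (u : Fin n → ℝ) (c : ℝ) : avg (fun i => u i * c) = avg u * c := by
  simp only [avg, ← Finset.sum_mul]; ring

lemma avg_finsetSum {ι : Type*} (s : Finset ι) (u : ι → Fin n → ℝ) :
    avg (fun i => ∑ j ∈ s, u j i) = ∑ j ∈ s, avg (u j) := by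
  simp only [avg, Finset.mul_sum]
  rw [Finset.sum_comm]

lemma avg_const [NeZero n] (c : ℝ) : avg (fun _ : Fin n => c) = c := by
  have : (n : ℝ) ≠ 0 := NeZero.ne _
  simp [avg, this]

/-- Empirical covariance. -/
noncomputable def empCov (u v : Fin n → ℝ) : ℝ := avg fun i => (u i - avg u) * (v i - avg v)

lemma empCov_eq (u v : Fin n → ℝ) : empCov u v = avg (fun i => u i * v i) - avg u * avg v := by
  rcases Nat.eq_zero_or_pos n with rfl | hn
  · simp [empCov, avg]
  have : NeZero n := ⟨hn.ne'⟩
  have h : (fun i => (u i - avg u) * (v i - avg v)) = fun i =>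
      (u i * v i - avg u * v i) - (u i * avg v - avg u * avg v) := by ext i; ring
  rw [empCov, h, avg_sub, avg_sub, avg_sub, avg_const, avg_const_mul, avg_mul_const]
  ring

lemma empCov_comm (u v : Fin n → ℝ) : empCov u v = empCov v u := by
  simp only [empCov, mul_comm]

lemma empCov_sub_const [NeZero n] (u v : Fin n → ℝ) (a b : ℝ) :
    empCov (fun i => u i - a) (fun i => v i - b) = empCov u v := by
  simp only [empCov, avg_sub, avg_const, sub_sub_sub_cancel_right]

lemma empCov_sub_right (u v w : Fin n → ℝ) :
    empCov u (fun i => v i - w i) = empCov u v - empCov u w := by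
  simp only [empCov_eq, mul_sub, avg_sub]
  ring

lemma empCov_const_mul_right (u v : Fin n → ℝ) (c : ℝ) :
    empCov u (fun i => c * v i) = c * empCov u v := by
  simp only [empCov_eq, mul_left_comm _ c, avg_const_mul]
  ring

lemma empCov_finsetSum_right {ι : Type*} (s : Finset ι) (u : Fin n → ℝ) (v : ι → Fin n → ℝ) :
    empCov u (fun i => ∑ j ∈ s, v j i) = ∑ j ∈ s, empCov u (v j) := by
  simp only [empCov_eq, Finset.mul_sum, avg_finsetSum, Finset.sum_sub_distrib]

lemma empVar_eq_empCov (z : EuclideanSpace ℝ (Fin n)) : empVar z = empCov z z := by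
  simp only [empVar, empCov, avg, sq]

/-- Empirical covariance matrix of the columns of `x`. -/
noncomputable def empCovMat (x : Fin n → Fin p → ℝ) : Matrix (Fin p) (Fin p) ℝ :=
  Matrix.of fun j k => empCov (fun i => x i j) (fun i => x i k)

/-- Empirical covariances of the columns of `x` with `y`. -/
noncomputable def empCovVec (x : Fin n → Fin p → ℝ) (y : Fin n → ℝ) : Fin p → ℝ :=
  fun j => empCov (fun i => x i j) y

/-- Empirical least squares coefficients. -/
noncomputable def empCoef (x : Fin n → Fin p → ℝ) (y : Fin n → ℝ) : Fin p → ℝ :=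
  (empCovMat x)⁻¹ *ᵥ empCovVec x y

/-- Empirical least squares fit. -/
noncomputable def empFit (x : Fin n → Fin p → ℝ) (y : Fin n → ℝ) (i : Fin n) : ℝ :=
  avg y + ∑ j, empCoef x y j * (x i j - avg fun i' => x i' j)

lemma empCovMat_mulVec (x : Fin n → Fin p → ℝ) (b : Fin p → ℝ) (k : Fin p) :
    (empCovMat x *ᵥ b) k = empCov (fun i => x i k) (fun i => ∑ j, b j * x i j) := by
  rw [empCov_finsetSum_right]
  simp only [empCov_const_mul_right, Matrix.mulVec, dotProduct, empCovMat, Matrix.of_apply]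
  exact Finset.sum_congr rfl fun j _ => mul_comm _ _

lemma empFit_eq_sub (x : Fin n → Fin p → ℝ) (y : Fin n → ℝ) (i : Fin n) :
    empFit x y i = (∑ j, empCoef x y j * x i j) -
      ((∑ j, empCoef x y j * avg fun i' => x i' j) - avg y) := by
  simp only [empFit, mul_sub, Finset.sum_sub_distrib]
  ring

lemma avg_empFit [NeZero n] (x : Fin n → Fin p → ℝ) (y : Fin n → ℝ) :
    avg (empFit x y) = avg y := by
  have h : empFit x y = fun i => _ := funext fun i => empFit_eq_sub x y i
  rw [h, avg_sub, avg_const, avg_finsetSum]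
  simp only [avg_const_mul]
  ring

/-- The empirical normal equations: the intercept does not affect covariances, and the inverse in
`empCoef` cancels. -/
lemma empCov_empFit [NeZero n] (x : Fin n → Fin p → ℝ) (y : Fin n → ℝ)
    (hS : IsUnit (empCovMat x).det) (k : Fin p) :
    empCov (fun i => x i k) (empFit x y) = empCov (fun i => x i k) y := by
  have h : empFit x y = fun i => _ := funext fun i => empFit_eq_sub x y i
  have h2 := empCov_sub_const (fun i => x i k) (fun i => ∑ j, empCoef x y j * x i j) 0
    ((∑ j, empCoef x y j * avg fun i' => x i' j) - avg y)
  simp only [sub_zero] at h2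
  rw [h, h2, ← empCovMat_mulVec, empCoef, Matrix.mulVec_mulVec, Matrix.mul_nonsing_inv _ hS,
    Matrix.one_mulVec, empCovVec]

lemma inner_toLp (u v : Fin n → ℝ) :
    inner ℝ (WithLp.toLp 2 u) (WithLp.toLp 2 v) = ∑ i, u i * v i := by
  simp [PiLp.inner_apply, mul_comm]

lemma sum_eq_mul_avg [NeZero n] (u : Fin n → ℝ) : ∑ i, u i = n * avg u := by
  have : (n : ℝ) ≠ 0 := NeZero.ne _
  rw [avg]; field_simp

/-- The fit is in the span, so only orthogonality to the generators is left. For the constant vector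
it says that the fit and `y` have equal means. For a column, equal means turn the normal equations
into equality of uncentered products. -/
lemma starProjection_eq_empFit [NeZero n] (x : Fin n → Fin p → ℝ) (y : Fin n → ℝ)
    (hS : IsUnit (empCovMat x).det) :
    (empSpan x).starProjection (WithLp.toLp 2 y) = WithLp.toLp 2 (empFit x y) := by
  refine Submodule.eq_starProjection_of_mem_of_inner_eq_zero ?_ fun w hw => ?_
  · refine (Submodule.mem_span_range_iff_exists_fun ℝ).2
      ⟨Fin.cons (avg y - ∑ j, empCoef x y j * avg fun i' => x i' j) (empCoef x y), ?_⟩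
    ext i
    rw [Fin.sum_univ_succ]
    simp [empFit_eq_sub]
    ring
  · have h0 : ∑ i, (y i - empFit x y i) = 0 := by
      rw [sum_eq_mul_avg, avg_sub, avg_empFit, sub_self, mul_zero]
    rw [← WithLp.toLp_sub]
    induction hw using Submodule.span_induction with
    | zero => simp
    | add u v _ _ hu hv => rw [inner_add_right, hu, hv, add_zero]
    | smul c u _ hu => rw [inner_smul_right, hu, mul_zero]
    | mem w hw =>
      obtain ⟨k, rfl⟩ := hw
      refine Fin.cases ?_ (fun k => ?_) k
      · rw [Matrix.cons_val_zero, inner_toLp]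
        simp only [mul_one]
        exact h0
      · rw [Matrix.cons_val_succ, inner_toLp, sum_eq_mul_avg]
        have h1 := empCov_empFit x y hS k
        rw [empCov_eq, empCov_eq, avg_empFit] at h1
        have h2 : (fun i => (y - empFit x y) i * x i k) =
            fun i => x i k * y i - x i k * empFit x y i := by
          ext i; simp only [Pi.sub_apply]; ring
        rw [h2, avg_sub]
        have : avg (fun i => x i k * empFit x y i) = avg fun i => x i k * y i := by linarith
        rw [this, sub_self, mul_zero]

lemma empR2_eq [NeZero n] (x : Fin n → Fin p → ℝ) (y : Fin n → ℝ)
    (hS : IsUnit (empCovMat x).det) :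
    empR2 x y = (empCoef x y ⬝ᵥ empCovVec x y) / empCov y y := by
  rw [empR2, starProjection_eq_empFit x y hS, empVar_eq_empCov, empVar_eq_empCov]
  congr 1
  change empCov (empFit x y) (empFit x y) = _
  have h : empFit x y = fun i => _ := funext fun i => empFit_eq_sub x y i
  have h2 := empCov_sub_const (empFit x y) (fun i => ∑ j, empCoef x y j * x i j) 0
    ((∑ j, empCoef x y j * avg fun i' => x i' j) - avg y)
  simp only [sub_zero] at h2
  rw [← h] at h2
  rw [h2, empCov_finsetSum_right]
  refine Finset.sum_congr rfl fun j _ => ?_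
  rw [empCov_const_mul_right, empCov_comm, empCov_empFit x y hS, empCovVec]

/-- The identity `θ̂ · α̂ - θ · α = θ · (α̂ - α) + α̂ · (θ̂ - θ)`. The shifts `mx`, `my` are free
because empirical covariances ignore constants; they will be the population means, making every
factor centered. -/
lemma empR2_sub_eq [NeZero n] (x : Fin n → Fin p → ℝ) (y : Fin n → ℝ)
    (hS : IsUnit (empCovMat x).det) (hv : empCov y y ≠ 0) (mx : Fin p → ℝ) (my : ℝ)
    (θ α : Fin p → ℝ) :
    empR2 x y - θ ⬝ᵥ α =
      ∑ j, (θ ᵥ* (empCovMat x)⁻¹) j * empCov (fun i => x i j - mx j)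
        (fun i => y i - my - ∑ k, α k * (x i k - mx k)) +
      ∑ k, empCoef x y k / empCov y y * empCov (fun i => y i - my)
        (fun i => x i k - mx k - θ k * (y i - my)) := by
  have h1 : (fun j => empCov (fun i => x i j - mx j)
        (fun i => y i - my - ∑ k, α k * (x i k - mx k))) =
      empCovVec x y - empCovMat x *ᵥ α := by
    ext j
    rw [empCov_sub_right, empCov_finsetSum_right]
    simp only [empCov_const_mul_right, empCov_sub_const, Pi.sub_apply, empCovVec, empCovMat_mulVec,
      empCov_finsetSum_right]
  have h2 : ∀ k, empCov (fun i => y i - my) (fun i => x i k - mx k - θ k * (y i - my)) =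
      empCovVec x y k - θ k * empCov y y := fun k => by
    rw [empCov_sub_right, empCov_const_mul_right, empCov_sub_const, empCov_sub_const, empCov_comm,
      empCovVec]
  have h3 : ∑ j, (θ ᵥ* (empCovMat x)⁻¹) j * empCov (fun i => x i j - mx j)
        (fun i => y i - my - ∑ k, α k * (x i k - mx k)) = θ ⬝ᵥ empCoef x y - θ ⬝ᵥ α := by
    change (θ ᵥ* (empCovMat x)⁻¹) ⬝ᵥ (fun j => empCov (fun i => x i j - mx j)
        (fun i => y i - my - ∑ k, α k * (x i k - mx k))) = _
    rw [h1, dotProduct_sub, ← Matrix.dotProduct_mulVec, ← Matrix.dotProduct_mulVec,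
      Matrix.mulVec_mulVec, Matrix.nonsing_inv_mul _ hS, Matrix.one_mulVec, empCoef]
  have h4 : ∑ k, empCoef x y k / empCov y y * empCov (fun i => y i - my)
        (fun i => x i k - mx k - θ k * (y i - my)) =
      (empCoef x y ⬝ᵥ empCovVec x y) / empCov y y - θ ⬝ᵥ empCoef x y := by
    simp only [h2, dotProduct, Finset.sum_div, ← Finset.sum_sub_distrib]
    refine Finset.sum_congr rfl fun k _ => ?_
    field_simp
  rw [h3, h4, empR2_eq x y hS]
  ring

/-! ### Measurability of the empirical coefficient. -/

lemma avg_starProjection (x : Fin n → Fin p → ℝ) (y : EuclideanSpace ℝ (Fin n)) :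
    avg ((empSpan x).starProjection y) = avg y := by
  have h := Submodule.starProjection_inner_eq_zero (K := empSpan x) y
    (WithLp.toLp 2 fun _ : Fin n => (1 : ℝ)) (Submodule.subset_span ⟨0, rfl⟩)
  have h2 : ∑ i, (y i - (empSpan x).starProjection y i) = 0 := by
    simpa [PiLp.inner_apply] using h
  rw [← sub_eq_zero, ← neg_sub, ← avg_sub, avg, h2, mul_zero, neg_zero]

lemma empVar_eq_norm (z : EuclideanSpace ℝ (Fin n)) :
    empVar z = 1 / (n : ℝ) * ‖z‖ ^ 2 - avg z ^ 2 := by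
  rw [empVar_eq_empCov, empCov_eq, EuclideanSpace.norm_sq_eq]
  simp [avg, sq]

/-- Pythagoras, valid without any rank condition. It leaves the distance from `y` to the span as the
only quantity whose measurability is not evident. -/
lemma empVar_starProjection (x : Fin n → Fin p → ℝ) (y : EuclideanSpace ℝ (Fin n)) :
    empVar ((empSpan x).starProjection y) =
      1 / (n : ℝ) * (‖y‖ ^ 2 - ‖y - (empSpan x).starProjection y‖ ^ 2) - avg y ^ 2 := by
  have h : inner ℝ ((empSpan x).starProjection y) (y - (empSpan x).starProjection y) = 0 := by
    rw [real_inner_comm]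
    exact Submodule.starProjection_inner_eq_zero y _ (Submodule.starProjection_apply_mem _ _)
  have h2 := norm_add_sq_eq_norm_sq_add_norm_sq_real h
  rw [add_sub_cancel] at h2
  rw [empVar_eq_norm, avg_starProjection, sq ‖y‖, h2]
  ring

/-- The linear combination of the generators of `empSpan x` with coefficients `a`. -/
noncomputable def empComb (x : Fin n → Fin p → ℝ) (a : Fin (p + 1) → ℝ) :
    EuclideanSpace ℝ (Fin n) :=
  WithLp.toLp 2 fun i => a 0 + ∑ j : Fin p, a j.succ * x i j

lemma mem_empSpan_iff (x : Fin n → Fin p → ℝ) (w : EuclideanSpace ℝ (Fin n)) :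
    w ∈ empSpan x ↔ ∃ a, empComb x a = w := by
  rw [Submodule.mem_span_range_iff_exists_fun]
  refine exists_congr fun a => ?_
  have : empComb x a = ∑ i, a i • (Matrix.vecCons (WithLp.toLp 2 (fun _ : Fin n => (1 : ℝ)))
    (fun j : Fin p => WithLp.toLp 2 (fun i : Fin n => x i j)) i : EuclideanSpace ℝ (Fin n)) := by
    ext i
    rw [Fin.sum_univ_succ]
    simp [empComb]
  rw [this]

/-- The projection minimizes the distance over the span, and the strict inequality is open in the
coefficients, so a countable dense set of coefficients suffices. -/
lemma norm_sub_starProjection_lt_iff (x : Fin n → Fin p → ℝ) (y : EuclideanSpace ℝ (Fin n))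
    (r : ℝ) : ‖y - (empSpan x).starProjection y‖ < r ↔
      ∃ m, ‖y - empComb x (TopologicalSpace.denseSeq (Fin (p + 1) → ℝ) m)‖ < r := by
  constructor
  · intro h
    obtain ⟨a, ha⟩ := (mem_empSpan_iff x _).1 (Submodule.starProjection_apply_mem (empSpan x) y)
    have ho : IsOpen {a : Fin (p + 1) → ℝ | ‖y - empComb x a‖ < r} := by
      refine isOpen_lt ?_ continuous_const
      unfold empComb
      fun_prop
    exact (TopologicalSpace.denseRange_denseSeq (Fin (p + 1) → ℝ)).exists_mem_open ho
      ⟨a, by simpa [ha] using h⟩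
  · rintro ⟨m, hm⟩
    refine lt_of_le_of_lt ?_ hm
    rw [Submodule.starProjection_minimal]
    exact ciInf_le ⟨0, by rintro _ ⟨w, rfl⟩; exact norm_nonneg _⟩
      (⟨_, (mem_empSpan_iff x _).2 ⟨_, rfl⟩⟩ : empSpan x)

/-- The explicit formula fails where the columns are degenerate, so measurability goes through the
distance to the span, whose strict sublevel sets are countable unions of open sets. -/
lemma measurable_empR2 :
    Measurable fun z : (Fin n → Fin p → ℝ) × (Fin n → ℝ) => empR2 z.1 z.2 := by
  have h1 : Measurable fun z : (Fin n → Fin p → ℝ) × (Fin n → ℝ) =>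
      ‖WithLp.toLp 2 z.2 - (empSpan z.1).starProjection (WithLp.toLp 2 z.2)‖ := by
    refine measurable_of_Iio fun r => ?_
    have : (fun z : (Fin n → Fin p → ℝ) × (Fin n → ℝ) =>
        ‖WithLp.toLp 2 z.2 - (empSpan z.1).starProjection (WithLp.toLp 2 z.2)‖) ⁻¹' Set.Iio r =
      ⋃ m, {z | ‖WithLp.toLp 2 z.2 -
        empComb z.1 (TopologicalSpace.denseSeq (Fin (p + 1) → ℝ) m)‖ < r} := by
      ext z
      simp [norm_sub_starProjection_lt_iff]
    rw [this]
    refine MeasurableSet.iUnion fun m => (isOpen_lt ?_ continuous_const).measurableSet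
    unfold empComb
    fun_prop
  have h2 : Continuous fun z : (Fin n → Fin p → ℝ) × (Fin n → ℝ) =>
      ‖(WithLp.toLp 2 z.2 : EuclideanSpace ℝ (Fin n))‖ := by fun_prop
  have h3 : Continuous fun z : (Fin n → Fin p → ℝ) × (Fin n → ℝ) => avg z.2 := by
    unfold avg; fun_prop
  simp only [empR2, empVar_starProjection]
  simp only [empVar_eq_norm]
  exact (((h2.measurable.pow_const 2).sub (h1.pow_const 2)).const_mul _ |>.sub
    (h3.measurable.pow_const 2)).div
    (((h2.measurable.pow_const 2).const_mul _).sub (h3.measurable.pow_const 2))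

end EmpiricalLemmas

/-! ### Calculus of sequences converging to zero in probability. -/

section ConvergenceInMeasure

variable {Ω : Type*} [MeasurableSpace Ω] {μ : Measure Ω} [IsProbabilityMeasure μ]

lemma tendstoInMeasure_zero_iff {f : ℕ → Ω → ℝ} : TendstoInMeasure μ f atTop 0 ↔
    ∀ ε > 0, Tendsto (fun n => μ.real {ω | ε ≤ |f n ω|}) atTop (nhds 0) := by
  simp [tendstoInMeasure_iff_measureReal_norm]

lemma tendstoInMeasure_zero_add {f g : ℕ → Ω → ℝ} (hf : TendstoInMeasure μ f atTop 0)
    (hg : TendstoInMeasure μ g atTop 0) :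
    TendstoInMeasure μ (fun n ω => f n ω + g n ω) atTop 0 := by
  rw [tendstoInMeasure_zero_iff] at *
  intro ε hε
  have h := (hf (ε / 2) (half_pos hε)).add (hg (ε / 2) (half_pos hε))
  rw [add_zero] at h
  refine squeeze_zero (fun _ => measureReal_nonneg) (fun n => ?_) h
  refine (measureReal_mono fun ω hω => ?_).trans (measureReal_union_le _ _)
  by_contra hc
  simp only [Set.mem_union, Set.mem_ofPred_eq, not_or, not_le] at hc hω
  have := abs_add_le (f n ω) (g n ω)
  linarith

lemma tendstoInMeasure_zero_finsetSum {ι : Type*} (s : Finset ι) {f : ι → ℕ → Ω → ℝ}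
    (hf : ∀ i, TendstoInMeasure μ (f i) atTop 0) :
    TendstoInMeasure μ (fun n ω => ∑ i ∈ s, f i n ω) atTop 0 := by
  classical
  induction s using Finset.induction_on with
  | empty =>
    rw [tendstoInMeasure_zero_iff]
    intro ε hε
    simp [not_le.2 hε]
  | insert i s hi ih =>
    simp only [Finset.sum_insert hi]
    exact tendstoInMeasure_zero_add (hf i) ih

/-- A sequence converging to zero in measure times a stochastically bounded one. -/
lemma tendstoInMeasure_zero_mul {f g : ℕ → Ω → ℝ} (hf : TendstoInMeasure μ f atTop 0) {C : ℝ}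
    (hg : ∀ n, ∀ K > 0, μ.real {ω | K ≤ |g n ω|} ≤ C / K ^ 2) :
    TendstoInMeasure μ (fun n ω => f n ω * g n ω) atTop 0 := by
  rw [tendstoInMeasure_zero_iff] at *
  intro ε hε
  rw [Metric.tendsto_nhds]
  intro η hη
  have hK : Tendsto (fun K : ℝ => C / K ^ 2) atTop (nhds 0) :=
    tendsto_const_nhds.div_atTop (tendsto_pow_atTop two_ne_zero)
  -- `K` is fixed first, making the tail of `g` smaller than `η / 2` for all `n`. Then `|f g| ≥ ε`
  -- forces `|f| ≥ ε / K` or `|g| ≥ K`.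
  obtain ⟨K, hK1, hK0⟩ :=
    ((hK.eventually_lt_const (half_pos hη)).and (eventually_gt_atTop 0)).exists
  filter_upwards [(hf (ε / K) (div_pos hε hK0)).eventually_lt_const (half_pos hη)] with n hn
  rw [Real.dist_eq, sub_zero, abs_of_nonneg measureReal_nonneg]
  have hle : μ.real {ω | ε ≤ |f n ω * g n ω|} ≤
      μ.real {ω | ε / K ≤ |f n ω|} + μ.real {ω | K ≤ |g n ω|} := by
    refine (measureReal_mono fun ω hω => ?_).trans (measureReal_union_le _ _)
    by_contra hc
    simp only [Set.mem_union, Set.mem_ofPred_eq, not_or, not_le] at hc hω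
    have := mul_lt_mul'' hc.1 hc.2 (abs_nonneg _) (abs_nonneg _)
    rw [div_mul_cancel₀ _ hK0.ne', ← abs_mul] at this
    linarith
  linarith [hg n K hK0]

end ConvergenceInMeasure

/-! ### Limit theorems for means of functions of the sample. -/

section Sampling

variable {Ω Ω' E : Type*} [MeasurableSpace Ω] [MeasurableSpace Ω'] [MeasurableSpace E]
  {P : Measure Ω} {P' : Measure Ω'}
  {D : ℕ → Ω' → E} {D₀ : Ω → E}

lemma avg_eq_sum_range_div (n : ℕ) (u : ℕ → ℝ) :
    avg (fun i : Fin n => u i) = (∑ i ∈ Finset.range n, u i) / n := by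
  rw [avg, Fin.sum_univ_eq_sum_range u n]; ring

lemma sqrt_mul_avg (n : ℕ) (u : ℕ → ℝ) :
    √(n : ℝ) * avg (fun i : Fin n => u i) = (√(n : ℝ))⁻¹ * ∑ i ∈ Finset.range n, u i := by
  rw [avg_eq_sum_range_div, mul_div_assoc', mul_comm, mul_div_assoc, Real.sqrt_div_self, mul_comm]

lemma ae_tendsto_avg (hindep : iIndepFun D P') (hident : ∀ i, IdentDistrib (D i) D₀ P' P)
    {g : E → ℝ} (hg : Measurable g) (hint : Integrable (fun ω => g (D₀ ω)) P) :
    ∀ᵐ ω ∂P', Tendsto (fun n : ℕ => avg fun i : Fin n => g (D i ω)) atTop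
      (nhds (∫ ω, g (D₀ ω) ∂P)) := by
  have h0 : ∀ i, IdentDistrib (g ∘ D i) (g ∘ D₀) P' P := fun i => (hident i).comp hg
  have h := strong_law_ae_real (fun i => g ∘ D i) ((h0 0).integrable_iff.2 hint)
    (fun i j hij => (hindep.comp (fun _ => g) fun _ => hg).indepFun hij)
    (fun i => (h0 i).trans (h0 0).symm)
  rw [(h0 0).integral_eq] at h
  filter_upwards [h] with ω hω
  simp only [avg_eq_sum_range_div _ fun i => g (D i ω)]
  exact hω

lemma aemeasurable_sqrt_mul_avg (hident : ∀ i, IdentDistrib (D i) D₀ P' P) {g : E → ℝ}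
    (hg : Measurable g) (n : ℕ) :
    AEMeasurable (fun ω => √(n : ℝ) * avg fun i : Fin n => g (D i ω)) P' := by
  have h : ∀ i, AEMeasurable (fun ω => g (D i ω)) P' := fun i =>
    hg.comp_aemeasurable (hident i).aemeasurable_fst
  have h2 : (fun ω => √(n : ℝ) * avg fun i : Fin n => g (D i ω)) =
      fun ω => (√(n : ℝ))⁻¹ * ∑ i ∈ Finset.range n, g (D i ω) :=
    funext fun ω => sqrt_mul_avg n fun i => g (D i ω)
  rw [h2]
  exact (Finset.aemeasurable_fun_sum _ fun i _ => h i).const_mul _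

lemma ae_tendsto_empCov [IsProbabilityMeasure P] (hindep : iIndepFun D P')
    (hident : ∀ i, IdentDistrib (D i) D₀ P' P)
    {f g : E → ℝ} (hf : Measurable f) (hg : Measurable g) (hf2 : MemLp (fun ω => f (D₀ ω)) 2 P)
    (hg2 : MemLp (fun ω => g (D₀ ω)) 2 P) :
    ∀ᵐ ω ∂P', Tendsto (fun n : ℕ => empCov (fun i : Fin n => f (D i ω)) fun i => g (D i ω)) atTop
      (nhds (cov[fun ω => f (D₀ ω), fun ω => g (D₀ ω); P])) := by
  filter_upwards [ae_tendsto_avg hindep hident (hf.mul hg) (hf2.integrable_mul hg2),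
    ae_tendsto_avg hindep hident hf (hf2.integrable one_le_two),
    ae_tendsto_avg hindep hident hg (hg2.integrable one_le_two)] with ω h1 h2 h3
  simp only [empCov_eq]
  rw [covariance_eq_sub hf2 hg2]
  exact h1.sub (h2.mul h3)

variable [IsProbabilityMeasure P']

/-- Chebyshev's inequality: the normalized mean has variance at most that of one copy, so the bound
is uniform in `n`. -/
lemma measureReal_le_abs_sqrt_mul_avg (hindep : iIndepFun D P')
    (hident : ∀ i, IdentDistrib (D i) D₀ P' P) {g : E → ℝ} (hg : Measurable g)
    (hg2 : MemLp (fun ω => g (D₀ ω)) 2 P) (hg0 : ∫ ω, g (D₀ ω) ∂P = 0) (n : ℕ) (K : ℝ)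
    (hK : 0 < K) :
    P'.real {ω | K ≤ |√(n : ℝ) * avg fun i : Fin n => g (D i ω)|} ≤
      Var[fun ω => g (D₀ ω); P] / K ^ 2 := by
  have h0 : ∀ i, IdentDistrib (g ∘ D i) (g ∘ D₀) P' P := fun i => (hident i).comp hg
  have h2 : ∀ i, MemLp (g ∘ D i) 2 P' := fun i => (h0 i).memLp_iff.2 hg2
  have hm : ∀ i, ∫ ω, (g ∘ D i) ω ∂P' = 0 := fun i => (h0 i).integral_eq.trans hg0
  set S : Ω' → ℝ := fun ω => (√(n : ℝ))⁻¹ * (∑ i ∈ Finset.range n, g ∘ D i) ω with hS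
  have hSL : MemLp S 2 P' := (memLp_finsetSum' _ fun i _ => h2 i).const_mul _
  have hSm : ∫ ω, S ω ∂P' = 0 := by
    simp only [hS, Finset.sum_apply]
    rw [integral_const_mul, integral_finsetSum _ fun i _ => (h2 i).integrable one_le_two]
    rw [Finset.sum_eq_zero fun i _ => hm i, mul_zero]
  -- Only an inequality, since the factor `n⁻¹ * n` is `0` at `n = 0`.
  have hSv : Var[S; P'] ≤ Var[fun ω => g (D₀ ω); P] := by
    rw [hS, variance_const_mul, IndepFun.variance_sum (fun i _ => h2 i) fun i _ j _ hij =>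
      (hindep.comp (fun _ => g) fun _ => hg).indepFun hij]
    simp only [fun i => (h0 i).variance_eq, Finset.sum_const, Finset.card_range, nsmul_eq_mul]
    rw [inv_pow, Real.sq_sqrt n.cast_nonneg, ← mul_assoc]
    exact mul_le_of_le_one_left (variance_nonneg _ _) inv_mul_le_one
  have h := meas_ge_le_variance_div_sq hSL hK
  rw [hSm] at h
  have hset : {ω | K ≤ |√(n : ℝ) * avg fun i : Fin n => g (D i ω)|} = {ω | K ≤ |S ω - 0|} := by
    ext ω
    simp only [Set.mem_ofPred_eq, sqrt_mul_avg n fun i => g (D i ω), hS, sub_zero,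
      Finset.sum_apply, Function.comp_apply]
  rw [hset, measureReal_def]
  exact (ENNReal.toReal_le_of_le_ofReal (div_nonneg (variance_nonneg _ _) (sq_nonneg _)) h).trans
    (by gcongr)

lemma tendstoInMeasure_mul_sqrt_mul_avg (hindep : iIndepFun D P')
    (hident : ∀ i, IdentDistrib (D i) D₀ P' P) {g : E → ℝ} (hg : Measurable g)
    (hg2 : MemLp (fun ω => g (D₀ ω)) 2 P) (hg0 : ∫ ω, g (D₀ ω) ∂P = 0) {A : ℕ → Ω' → ℝ}
    (hA : ∀ n, AEMeasurable (A n) P')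
    (hA0 : ∀ᵐ ω ∂P', Tendsto (fun n => A n ω) atTop (nhds 0)) :
    TendstoInMeasure P' (fun n ω => A n ω * (√(n : ℝ) * avg fun i : Fin n => g (D i ω)))
      atTop 0 :=
  tendstoInMeasure_zero_mul
    (tendstoInMeasure_of_tendsto_ae (fun n => (hA n).aestronglyMeasurable) hA0)
    (measureReal_le_abs_sqrt_mul_avg hindep hident hg hg2 hg0)

lemma tendstoInDistribution_sqrt_mul_avg (hindep : iIndepFun D P')
    (hident : ∀ i, IdentDistrib (D i) D₀ P' P) {g : E → ℝ} (hg : Measurable g)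
    (hg2 : MemLp (fun ω => g (D₀ ω)) 2 P) (hg0 : ∫ ω, g (D₀ ω) ∂P = 0) :
    TendstoInDistribution (fun (n : ℕ) ω => √(n : ℝ) * avg fun i : Fin n => g (D i ω)) atTop
      (id : ℝ → ℝ) (fun _ => P') (gaussianReal 0 (∫ ω, g (D₀ ω) ^ 2 ∂P).toNNReal) := by
  have h0 : ∀ i, IdentDistrib (g ∘ D i) (g ∘ D₀) P' P := fun i => (hident i).comp hg
  have hm : ∫ ω, (g ∘ D 0) ω ∂P' = 0 := (h0 0).integral_eq.trans hg0
  have hv : Var[g ∘ D 0; P'] = ∫ ω, g (D₀ ω) ^ 2 ∂P := by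
    rw [(h0 0).variance_eq]
    exact variance_of_integral_eq_zero hg2.aemeasurable hg0
  have h := tendstoInDistribution_inv_sqrt_mul_sum_sub (X := fun i => g ∘ D i) (P := P')
    (P' := gaussianReal 0 (∫ ω, g (D₀ ω) ^ 2 ∂P).toNNReal) (Y := id)
    (by rw [hv]; exact HasLaw.id) ((h0 0).memLp_iff.2 hg2)
    (hindep.comp (fun _ => g) fun _ => hg) (fun i => (h0 i).trans (h0 0).symm)
  simp only [hm, mul_zero, sub_zero] at h
  convert! h using 3 with n ω
  exact sqrt_mul_avg n fun i => g (D i ω)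

end Sampling

/-! ### Continuity and measurability of the matrix inverse. -/

section MatrixInverse

variable {p : ℕ}

/-- Holds for singular matrices too, both inverses then being zero. It thus serves for limits at
invertible matrices and for measurability everywhere. -/
lemma inv_apply_eq (M : Matrix (Fin p) (Fin p) ℝ) (j k : Fin p) :
    M⁻¹ j k = M.det⁻¹ * M.adjugate j k := by
  rw [Matrix.inv_def, Ring.inverse_eq_inv', Matrix.smul_apply, smul_eq_mul]

lemma tendsto_inv_apply {S : ℕ → Matrix (Fin p) (Fin p) ℝ} {M : Matrix (Fin p) (Fin p) ℝ}
    (h : ∀ j k, Tendsto (fun n => S n j k) atTop (nhds (M j k))) (hM : IsUnit M.det) :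
    (∀ᶠ n in atTop, IsUnit (S n).det) ∧
      ∀ j k, Tendsto (fun n => (S n)⁻¹ j k) atTop (nhds (M⁻¹ j k)) := by
  have hS : Tendsto S atTop (nhds M) :=
    tendsto_pi_nhds.2 fun j => tendsto_pi_nhds.2 fun k => h j k
  have hdet : Tendsto (fun n => (S n).det) atTop (nhds M.det) :=
    ((continuous_id.matrix_det).tendsto M).comp hS
  have hM0 := isUnit_iff_ne_zero.1 hM
  refine ⟨(hdet.eventually_ne hM0).mono fun n hn => isUnit_iff_ne_zero.2 hn, fun j k => ?_⟩
  simp only [inv_apply_eq]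
  refine (hdet.inv₀ hM0).mul ?_
  exact (((continuous_id.matrix_adjugate).matrix_elem j k).tendsto M).comp hS

lemma continuous_empCov {n : ℕ} {T : Type*} [TopologicalSpace T] {u v : T → Fin n → ℝ}
    (hu : Continuous u) (hv : Continuous v) : Continuous fun t => empCov (u t) (v t) := by
  unfold empCov avg
  fun_prop

lemma measurable_inv_empCovMat {n : ℕ} (j k : Fin p) :
    Measurable fun x : Fin n → Fin p → ℝ => (empCovMat x)⁻¹ j k := by
  have hc : Continuous fun x : Fin n → Fin p → ℝ => empCovMat x :=
    continuous_matrix fun j k => continuous_empCov (by fun_prop) (by fun_prop)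
  simp only [inv_apply_eq]
  exact hc.matrix_det.measurable.inv.mul (hc.matrix_adjugate.matrix_elem j k).measurable

end MatrixInverse

/-! ### Slutsky argument for randomly weighted empirical covariances. -/

section WeightedCovariances

variable {Ω Ω' E : Type*} [MeasurableSpace Ω] [MeasurableSpace Ω'] [MeasurableSpace E]
  {P : Measure Ω} [IsProbabilityMeasure P] {P' : Measure Ω'} [IsProbabilityMeasure P']
  {D : ℕ → Ω' → E} {D₀ : Ω → E}

/-- Asymptotic normality of a linear combination, with random convergent weights, of empirical
covariances of uncorrelated centered variables. -/
lemma tendstoInDistribution_sum_mul_empCov {ι : Type*} [Fintype ι] (hindep : iIndepFun D P')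
    (hident : ∀ i, IdentDistrib (D i) D₀ P' P) {f h : ι → E → ℝ} (hf : ∀ a, Measurable (f a))
    (hh : ∀ a, Measurable (h a)) (hf2 : ∀ a, MemLp (fun ω => f a (D₀ ω)) 2 P)
    (hh2 : ∀ a, MemLp (fun ω => h a (D₀ ω)) 2 P)
    (hfh2 : ∀ a, MemLp (fun ω => f a (D₀ ω) * h a (D₀ ω)) 2 P)
    (hf0 : ∀ a, ∫ ω, f a (D₀ ω) ∂P = 0) (hh0 : ∀ a, ∫ ω, h a (D₀ ω) ∂P = 0)
    (hfh0 : ∀ a, ∫ ω, f a (D₀ ω) * h a (D₀ ω) ∂P = 0)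
    {c : ι → ℕ → Ω' → ℝ} {w : ι → ℝ} (hc : ∀ a n, AEMeasurable (c a n) P')
    (hcw : ∀ a, ∀ᵐ ω ∂P', Tendsto (fun n => c a n ω) atTop (nhds (w a)))
    {T : ℕ → Ω' → ℝ} (hT : ∀ n, AEMeasurable (T n) P')
    (hTc : ∀ᵐ ω ∂P', ∀ᶠ n : ℕ in atTop, T n ω = ∑ a, c a n ω *
      empCov (fun i : Fin n => f a (D i ω)) (fun i : Fin n => h a (D i ω))) :
    TendstoInDistribution (fun (n : ℕ) ω => √(n : ℝ) * T n ω) atTop (id : ℝ → ℝ) (fun _ => P')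
      (gaussianReal 0 (∫ ω, (∑ a, w a * (f a (D₀ ω) * h a (D₀ ω))) ^ 2 ∂P).toNNReal) := by
  have hfh : ∀ a, Measurable fun z => f a z * h a z := fun a => (hf a).mul (hh a)
  have hg : Measurable fun z => ∑ a, w a * (f a z * h a z) :=
    Finset.measurable_sum _ fun a _ => (hfh a).const_mul _
  have hmain := tendstoInDistribution_sqrt_mul_avg hindep hident hg
    (memLp_finsetSum _ fun a _ => (hfh2 a).const_mul (w a)) (by
      rw [integral_finsetSum _ fun a _ => ((hfh2 a).integrable one_le_two).const_mul _]
      simp only [integral_const_mul, hfh0, mul_zero, Finset.sum_const_zero])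
  -- By `empCov = avg (f h) - avg f * avg h`, this is the error of replacing `c` by `w` and dropping
  -- the product of means. In each summand an almost surely null factor (`c - w`, or `c * avg f`)
  -- multiplies a `√n`-normalized mean that is bounded in probability.
  let R : ℕ → Ω' → ℝ := fun n ω => ∑ a,
    ((c a n ω - w a) * (√(n : ℝ) * avg fun i : Fin n => f a (D i ω) * h a (D i ω)) +
      -(c a n ω * avg fun i : Fin n => f a (D i ω)) *
        (√(n : ℝ) * avg fun i : Fin n => h a (D i ω)))
  have hD : ∀ i, AEMeasurable (D i) P' := fun i => (hident i).aemeasurable_fst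
  have havg : ∀ a n, AEMeasurable (fun ω => avg fun i : Fin n => f a (D i ω)) P' := fun a n => by
    have hm : ∀ i : Fin n, AEMeasurable (fun ω => f a (D i ω)) P' := fun i =>
      (hf a).comp_aemeasurable (hD i)
    exact (Finset.aemeasurable_fun_sum _ fun i _ => hm i).const_mul _
  have hR : TendstoInMeasure P' R atTop 0 := by
    refine tendstoInMeasure_zero_finsetSum _ fun a => tendstoInMeasure_zero_add ?_ ?_
    · refine tendstoInMeasure_mul_sqrt_mul_avg hindep hident (hfh a) (hfh2 a) (hfh0 a)
        (fun n => (hc a n).sub_const _) ?_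
      filter_upwards [hcw a] with ω hω
      simpa using hω.sub_const (w a)
    · refine tendstoInMeasure_mul_sqrt_mul_avg hindep hident (hh a) (hh2 a) (hh0 a)
        (fun n => ((hc a n).mul (havg a n)).neg) ?_
      filter_upwards [hcw a,
        ae_tendsto_avg hindep hident (hf a) ((hf2 a).integrable one_le_two)] with ω h1 h2
      rw [hf0 a] at h2
      simpa using (h1.mul h2).neg
  have hRm : ∀ n, AEMeasurable (R n) P' := fun n =>
    Finset.aemeasurable_fun_sum _ fun a _ =>
      (((hc a n).sub_const _).mul (aemeasurable_sqrt_mul_avg hident (hfh a) n)).add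
        (((hc a n).mul (havg a n)).neg.mul (aemeasurable_sqrt_mul_avg hident (hh a) n))
  have hTm : ∀ n : ℕ, AEMeasurable (fun ω => √(n : ℝ) * T n ω) P' := fun n => (hT n).const_mul _
  refine tendstoInDistribution_of_tendstoInMeasure_sub _ _ hmain ?_ hTm
  -- The expansion of `T` holds only eventually, almost surely. There the difference is exactly
  -- zero, which is enough.
  have hdiff : TendstoInMeasure P' (fun (n : ℕ) ω => √(n : ℝ) * T n ω -
      (√(n : ℝ) * avg fun i : Fin n => ∑ a, w a * (f a (D i ω) * h a (D i ω))) - R n ω)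
      atTop 0 := by
    refine tendstoInMeasure_of_tendsto_ae (fun n => (((hTm n).sub
      (aemeasurable_sqrt_mul_avg hident hg n)).sub (hRm n)).aestronglyMeasurable) ?_
    filter_upwards [hTc] with ω hω
    refine tendsto_const_nhds.congr' ?_
    filter_upwards [hω] with n hn
    rw [hn, avg_finsetSum, Finset.mul_sum, Finset.mul_sum, ← Finset.sum_sub_distrib,
      ← Finset.sum_sub_distrib, Pi.zero_apply, eq_comm]
    refine Finset.sum_eq_zero fun a _ => ?_
    rw [avg_const_mul, empCov_eq]
    ring
  convert! tendstoInMeasure_zero_add hdiff hR using 3 with n ω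
  simp

end WeightedCovariances

/-! ### The scores as functions of the observed values. -/

section ScoreFactor

variable {Ω : Type*} [MeasurableSpace Ω] {P : Measure Ω} {p : ℕ} {X : Fin p → Lp ℝ 2 P}
  {Y : Lp ℝ 2 P}

/-- First factors of `scoreVar`, as functions of the value `z` of `(Y, X)`. -/
noncomputable def scoreFst (X : Fin p → Lp ℝ 2 P) (Y : Lp ℝ 2 P) :
    Fin p ⊕ Fin p → ℝ × (Fin p → ℝ) → ℝ :=
  Sum.elim (fun j z => z.2 j - ∫ ω, X j ω ∂P) (fun _ z => z.1 - ∫ ω, Y ω ∂P)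

lemma measurable_scoreFst (a : Fin p ⊕ Fin p) : Measurable (scoreFst X Y a) := by
  rcases a with a | a <;> simp only [scoreFst, Sum.elim_inl, Sum.elim_inr] <;> fun_prop

end ScoreFactor

/-! ### Convergence of the weights and asymptotic normality of `R̂²`. -/

section AsymptoticNormality

variable {Ω Ω' : Type*} [MeasurableSpace Ω] [MeasurableSpace Ω'] {P : Measure Ω}
  [IsProbabilityMeasure P] {P' : Measure Ω'} {p : ℕ}
  {X : Fin p → Lp ℝ 2 P} {Y : Lp ℝ 2 P}

/-- Second factors of `scoreVar`, as functions of the value `z` of `(Y, X)`. -/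
noncomputable def scoreSnd (X : Fin p → Lp ℝ 2 P) (hli : LinearIndependent ℝ (withOne X))
    (Y : Lp ℝ 2 P) : Fin p ⊕ Fin p → ℝ × (Fin p → ℝ) → ℝ :=
  Sum.elim
    (fun _ z => z.1 - (∫ ω, Y ω ∂P) - ∑ k, alpha X hli Y k * (z.2 k - ∫ ω, X k ω ∂P))
    (fun k z => z.2 k - (∫ ω, X k ω ∂P) - theta X Y k * (z.1 - ∫ ω, Y ω ∂P))

/-- Weights of the empirical covariances in the expansion of `empR2`. -/
noncomputable def empScoreWeight (θ : Fin p → ℝ) {n : ℕ} (x : Fin n → Fin p → ℝ) (y : Fin n → ℝ) :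
    Fin p ⊕ Fin p → ℝ :=
  Sum.elim (θ ᵥ* (empCovMat x)⁻¹) (fun k => empCoef x y k / empCov y y)

lemma measurable_scoreSnd (hli : LinearIndependent ℝ (withOne X)) (a : Fin p ⊕ Fin p) :
    Measurable (scoreSnd X hli Y a) := by
  rcases a with a | a <;> simp only [scoreSnd, Sum.elim_inl, Sum.elim_inr] <;> fun_prop

lemma measurable_empScoreWeight (θ : Fin p → ℝ) {n : ℕ} (a : Fin p ⊕ Fin p) :
    Measurable fun z : (Fin n → Fin p → ℝ) × (Fin n → ℝ) => empScoreWeight θ z.1 z.2 a := by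
  have hinv : ∀ j k, Measurable fun z : (Fin n → Fin p → ℝ) × (Fin n → ℝ) =>
      (empCovMat z.1)⁻¹ j k := fun j k => (measurable_inv_empCovMat j k).comp measurable_fst
  have hxy : ∀ k, Measurable fun z : (Fin n → Fin p → ℝ) × (Fin n → ℝ) =>
      empCovVec z.1 z.2 k := fun k =>
    (continuous_empCov (by fun_prop) (by fun_prop)).measurable
  have hyy : Measurable fun z : (Fin n → Fin p → ℝ) × (Fin n → ℝ) => empCov z.2 z.2 :=
    (continuous_empCov (by fun_prop) (by fun_prop)).measurable
  rcases a with a | a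
  · simp only [empScoreWeight, Sum.elim_inl, Matrix.vecMul, dotProduct]
    exact Finset.measurable_sum _ fun k _ => (hinv k a).const_mul (θ k)
  · simp only [empScoreWeight, Sum.elim_inr, empCoef, Matrix.mulVec, dotProduct]
    exact (Finset.measurable_sum _ fun k _ => (hinv a k).mul (hxy k)).div hyy

lemma empR2_sub_R2_eq (hli : LinearIndependent ℝ (withOne X)) {n : ℕ} [NeZero n]
    (x : Fin n → Fin p → ℝ) (y : Fin n → ℝ) (hS : IsUnit (empCovMat x).det)
    (hv : empCov y y ≠ 0) :
    empR2 x y - R2 X Y = ∑ a, empScoreWeight (theta X Y) x y a *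
      empCov (fun i => scoreFst X Y a (y i, x i)) (fun i => scoreSnd X hli Y a (y i, x i)) := by
  rw [R2_eq hli, empR2_sub_eq x y hS hv (fun j => ∫ ω, X j ω ∂P) (∫ ω, Y ω ∂P),
    Fintype.sum_sum_type]
  rfl

/-- The residuals are classes in `L²(P)` and cannot be evaluated on the copies. This replaces them
by explicit measurable functions of `(Y, X)`, which can. -/
lemma scoreFst_mul_scoreSnd_ae_eq (hli : LinearIndependent ℝ (withOne X)) (hvar : Var[Y; P] ≠ 0)
    (a : Fin p ⊕ Fin p) :
    scoreVar X Y a =ᵐ[P] fun ω => scoreFst X Y a (Y ω, fun j => X j ω) *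
      scoreSnd X hli Y a (Y ω, fun j => X j ω) := by
  rcases a with a | a
  · filter_upwards [eps_ae_eq hli Y] with ω hω
    simp only [scoreVar, scoreFst, scoreSnd, Sum.elim_inl, hω]
  · filter_upwards [revRes_ae_eq X hvar a] with ω hω
    simp only [scoreVar, scoreFst, scoreSnd, Sum.elim_inr, hω]

lemma memLp_scoreFst (a : Fin p ⊕ Fin p) :
    MemLp (fun ω => scoreFst X Y a (Y ω, fun j => X j ω)) 2 P := by
  rcases a with a | a
  · exact memLp_sub_integral (X a)
  · exact memLp_sub_integral Y

lemma integral_scoreFst (a : Fin p ⊕ Fin p) :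
    ∫ ω, scoreFst X Y a (Y ω, fun j => X j ω) ∂P = 0 := by
  rcases a with a | a
  · exact integral_sub_integral (X a)
  · exact integral_sub_integral Y

lemma exists_scoreSnd_ae_eq (hli : LinearIndependent ℝ (withOne X)) (hvar : Var[Y; P] ≠ 0)
    (a : Fin p ⊕ Fin p) : ∃ u : Lp ℝ 2 P,
      u =ᵐ[P] (fun ω => scoreSnd X hli Y a (Y ω, fun j => X j ω)) ∧ ∫ ω, u ω ∂P = 0 := by
  rcases a with a | a
  · exact ⟨_, eps_ae_eq hli Y, integral_linRes X Y⟩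
  · exact ⟨_, revRes_ae_eq X hvar a, integral_linRes _ _⟩

/-- All empirical covariances converge almost surely, and inversion is continuous at the invertible
matrix `M₀`. The same convergence makes the error expansion eventually valid. -/
lemma ae_tendsto_empScoreWeight (hli : LinearIndependent ℝ (withOne X)) (hvar : Var[Y; P] ≠ 0)
    {D : ℕ → Ω' → ℝ × (Fin p → ℝ)} (hindep : iIndepFun D P')
    (hident : ∀ i, IdentDistrib (D i) (fun ω => (Y ω, fun j => X j ω)) P' P) :
    ∀ᵐ ω ∂P',
      (∀ᶠ n : ℕ in atTop, IsUnit (empCovMat fun (i : Fin n) => (D i ω).2).det ∧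
        empCov (fun i : Fin n => (D i ω).1) (fun i : Fin n => (D i ω).1) ≠ 0) ∧
      ∀ a, Tendsto (fun n : ℕ => empScoreWeight (theta X Y) (fun i : Fin n => (D i ω).2)
        (fun i : Fin n => (D i ω).1) a) atTop (nhds (scoreWeight X hli Y a)) := by
  have hX : ∀ j : Fin p, Measurable fun z : ℝ × (Fin p → ℝ) => z.2 j := fun j => by fun_prop
  have h1 : ∀ᵐ ω ∂P', ∀ j k, Tendsto (fun n : ℕ => empCovMat (fun i : Fin n => (D i ω).2) j k)
      atTop (nhds (covMat X j k)) := by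
    refine ae_all_iff.2 fun j => ae_all_iff.2 fun k => ?_
    have h := ae_tendsto_empCov (f := fun z => z.2 j) (g := fun z => z.2 k) hindep hident (hX j)
      (hX k) (Lp.memLp (X j)) (Lp.memLp (X k))
    simpa only [empCovMat, covMat, Matrix.of_apply] using h
  have h2 : ∀ᵐ ω ∂P', ∀ j, Tendsto (fun n : ℕ => empCovVec (fun i : Fin n => (D i ω).2)
      (fun i : Fin n => (D i ω).1) j) atTop (nhds (cov[X j, Y; P])) := by
    refine ae_all_iff.2 fun j => ?_
    have h := ae_tendsto_empCov (f := fun z => z.2 j) (g := Prod.fst) hindep hident (hX j)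
      measurable_fst (Lp.memLp (X j)) (Lp.memLp Y)
    simpa only [empCovVec] using h
  have h3 := ae_tendsto_empCov (f := Prod.fst) (g := Prod.fst) hindep hident measurable_fst
    measurable_fst (Lp.memLp Y) (Lp.memLp Y)
  rw [covariance_self (Lp.aestronglyMeasurable Y).aemeasurable] at h3
  filter_upwards [h1, h2, h3] with ω h1 h2 h3
  obtain ⟨hu, hinv⟩ := tendsto_inv_apply h1 (isUnit_det_covMat hli)
  refine ⟨hu.and (h3.eventually_ne hvar), fun a => ?_⟩
  rcases a with a | a
  -- The empirical weight multiplies `θ` on the left of the inverse, the limiting one on the right;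
  -- they match by symmetry of `M₀`.
  · have hsymm : scoreWeight X hli Y (Sum.inl a) = (theta X Y ᵥ* (covMat X)⁻¹) a := by
      rw [scoreWeight, Sum.elim_inl, ← Matrix.vecMul_transpose, Matrix.transpose_nonsing_inv,
        (covMat_isSymm X).eq]
    rw [hsymm]
    simp only [empScoreWeight, Sum.elim_inl, Matrix.vecMul, dotProduct]
    exact tendsto_finsetSum _ fun k _ => (hinv k a).const_mul (theta X Y k)
  · rw [scoreWeight, Sum.elim_inr, ← inv_covMat_mulVec_cov hli Y]
    simp only [empScoreWeight, Sum.elim_inr, empCoef, Matrix.mulVec, dotProduct]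
    exact (tendsto_finsetSum _ fun k _ => (hinv a k).mul (h2 k)).div h3 hvar

/-- Asymptotic normality of the empirical multiple correlation coefficient, for elements of `L²`. -/
theorem tendstoInDistribution_empR2 [IsProbabilityMeasure P'] (hvar : Var[Y; P] ≠ 0)
    (hli : LinearIndependent ℝ (withOne X))
    (hXeps : ∀ j, Integrable (fun ω => (X j ω - ∫ ω', X j ω' ∂P) ^ 2 * (eps X Y ω) ^ 2) P)
    (hYe : ∀ j, Integrable (fun ω => (Y ω - ∫ ω', Y ω' ∂P) ^ 2 * (revRes X Y j ω) ^ 2) P)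
    {D : ℕ → Ω' → ℝ × (Fin p → ℝ)} (hindep : iIndepFun D P')
    (hident : ∀ i, IdentDistrib (D i) (fun ω => (Y ω, fun j => X j ω)) P' P) :
    TendstoInDistribution (fun (n : ℕ) ω => √(n : ℝ) *
        (empR2 (fun i : Fin n => (D i ω).2) (fun i : Fin n => (D i ω).1) - R2 X Y))
      atTop (id : ℝ → ℝ) (fun _ => P') (gaussianReal 0 (limVar X hli Y).toNNReal) := by
  have hL := memLp_scoreVar hXeps hYe
  have hae := scoreFst_mul_scoreSnd_ae_eq (Y := Y) hli hvar
  have hlim : limVar X hli Y = ∫ ω, (∑ a, scoreWeight X hli Y a *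
      (scoreFst X Y a (Y ω, fun j => X j ω) * scoreSnd X hli Y a (Y ω, fun j => X j ω))) ^ 2 ∂P := by
    rw [limVar_eq_integral_sq hli Y hL]
    refine integral_congr_ae ?_
    filter_upwards [ae_all_iff.2 hae] with ω hω
    simp only [hω]
  have hdata : ∀ n : ℕ, AEMeasurable (fun ω => ((fun i : Fin n => (D i ω).2),
      (fun i : Fin n => (D i ω).1))) P' := fun n =>
    (aemeasurable_pi_lambda (fun ω (i : Fin n) => (D i ω).2)
      fun i => (hident i).aemeasurable_fst.snd).prodMk
    (aemeasurable_pi_lambda (fun ω (i : Fin n) => (D i ω).1)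
      fun i => (hident i).aemeasurable_fst.fst)
  have hw := ae_tendsto_empScoreWeight hli hvar hindep hident
  have hsnd : ∀ a, MemLp (fun ω => scoreSnd X hli Y a (Y ω, fun j => X j ω)) 2 P ∧
      ∫ ω, scoreSnd X hli Y a (Y ω, fun j => X j ω) ∂P = 0 := fun a => by
    obtain ⟨u, hu, hu0⟩ := exists_scoreSnd_ae_eq (Y := Y) hli hvar a
    exact ⟨(memLp_congr_ae hu).1 (Lp.memLp u), by rw [← integral_congr_ae hu, hu0]⟩
  have hprod : ∀ a, ∫ ω, scoreFst X Y a (Y ω, fun j => X j ω) *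
      scoreSnd X hli Y a (Y ω, fun j => X j ω) ∂P = 0 := fun a => by
    rw [← integral_congr_ae (hae a), integral_scoreVar]
  have hc : ∀ a (n : ℕ), AEMeasurable (fun ω => empScoreWeight (theta X Y)
      (fun i : Fin n => (D i ω).2) (fun i : Fin n => (D i ω).1) a) P' := fun a n => by
    have h := (measurable_empScoreWeight (n := n) (theta X Y) a).comp_aemeasurable (hdata n)
    exact h
  have hT : ∀ n : ℕ, AEMeasurable (fun ω => empR2 (fun i : Fin n => (D i ω).2)
      (fun i : Fin n => (D i ω).1) - R2 X Y) P' := fun n =>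
    (measurable_empR2.comp_aemeasurable (hdata n)).sub_const _
  have hTc : ∀ᵐ ω ∂P', ∀ᶠ n : ℕ in atTop, empR2 (fun i : Fin n => (D i ω).2)
      (fun i : Fin n => (D i ω).1) - R2 X Y = ∑ a, empScoreWeight (theta X Y)
        (fun i : Fin n => (D i ω).2) (fun i : Fin n => (D i ω).1) a *
          empCov (fun i : Fin n => scoreFst X Y a (D i ω))
            (fun i : Fin n => scoreSnd X hli Y a (D i ω)) := by
    filter_upwards [hw] with ω hω
    filter_upwards [hω.1, eventually_gt_atTop 0] with n hn hn0
    have : NeZero n := ⟨hn0.ne'⟩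
    exact empR2_sub_R2_eq hli _ _ hn.1 hn.2
  rw [hlim]
  exact tendstoInDistribution_sum_mul_empCov (f := scoreFst X Y) (h := scoreSnd X hli Y)
    (w := scoreWeight X hli Y) (D₀ := fun ω => (Y ω, fun j => X j ω)) hindep hident
    measurable_scoreFst (measurable_scoreSnd hli) memLp_scoreFst (fun a => (hsnd a).1)
    (fun a => (memLp_congr_ae (hae a)).1 (hL a)) integral_scoreFst (fun a => (hsnd a).2) hprod hc
    (fun a => hw.mono fun ω hω => hω.2 a) hT hTc

end AsymptoticNormality

end MultCorr

/-- `(Y, X⁽¹⁾, …, X⁽ᵖ⁾)` is a vector of square integrable variables on `(Ω, P)`, and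
`(Ys i, Xs i)`, `i : ℕ`, are independent copies of it on `(Ω', P')`; the sample of size `n` consists
of the copies with `i < n`. -/
theorem proposition3p2 {Ω Ω' : Type*} [MeasurableSpace Ω] [MeasurableSpace Ω']
    (P : Measure Ω) [IsProbabilityMeasure P] (P' : Measure Ω') [IsProbabilityMeasure P']
    (p : ℕ) (Y : Ω → ℝ) (X : Fin p → Ω → ℝ)
    (hY : MemLp Y 2 P) (hX : ∀ j, MemLp (X j) 2 P)
    (hvar : 0 < Var[Y; P])
    (hli : LinearIndependent ℝ (MultCorr.withOne fun j => (hX j).toLp (X j)))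
    (hXeps : ∀ j, Integrable (fun ω => (X j ω - ∫ ω', X j ω' ∂P) ^ 2 *
      (MultCorr.eps (fun j => (hX j).toLp (X j)) (hY.toLp Y) ω) ^ 2) P)
    (hYe : ∀ j, Integrable (fun ω => (Y ω - ∫ ω', Y ω' ∂P) ^ 2 *
      (MultCorr.revRes (fun j => (hX j).toLp (X j)) (hY.toLp Y) j ω) ^ 2) P)
    (Ys : ℕ → Ω' → ℝ) (Xs : ℕ → Fin p → Ω' → ℝ)
    (hindep : iIndepFun (fun (i : ℕ) (ω : Ω') => (Ys i ω, fun j => Xs i j ω)) P')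
    (hident : ∀ i, IdentDistrib (fun ω : Ω' => (Ys i ω, fun j => Xs i j ω))
      (fun ω : Ω => (Y ω, fun j => X j ω)) P' P) :
    0 ≤ MultCorr.limVar (fun j => (hX j).toLp (X j)) hli (hY.toLp Y) ∧
    TendstoInDistribution
      (fun (n : ℕ) (ω : Ω') => √(n : ℝ) *
        (MultCorr.empR2 (fun (i : Fin n) j => Xs i j ω) (fun i : Fin n => Ys i ω) -
          MultCorr.R2 (fun j => (hX j).toLp (X j)) (hY.toLp Y)))
      atTop (id : ℝ → ℝ) (fun _ => P')
      (gaussianReal 0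
        (MultCorr.limVar (fun j => (hX j).toLp (X j)) hli (hY.toLp Y)).toNNReal) := by
  have haeX := fun j => (hX j).coeFn_toLp
  have haeY := hY.coeFn_toLp
  have hvar' : Var[hY.toLp Y; P] ≠ 0 := by
    rw [variance_congr haeY]
    exact hvar.ne'
  have hmX := fun j => integral_congr_ae (haeX j)
  have hmY := integral_congr_ae haeY
  have hXeps' : ∀ j, Integrable (fun ω =>
      ((hX j).toLp (X j) ω - ∫ ω', (hX j).toLp (X j) ω' ∂P) ^ 2 *
        (MultCorr.eps (fun j => (hX j).toLp (X j)) (hY.toLp Y) ω) ^ 2) P := fun j => by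
    refine (hXeps j).congr ?_
    filter_upwards [haeX j] with ω hω
    rw [hω, hmX j]
  have hYe' : ∀ j, Integrable (fun ω => (hY.toLp Y ω - ∫ ω', hY.toLp Y ω' ∂P) ^ 2 *
      (MultCorr.revRes (fun j => (hX j).toLp (X j)) (hY.toLp Y) j ω) ^ 2) P := fun j => by
    refine (hYe j).congr ?_
    filter_upwards [haeY] with ω hω
    rw [hω, hmY]
  -- The `L²` representatives differ from `Y` and `X` only on a null set, so the joint law is
  -- unchanged.
  have hident' : ∀ i, IdentDistrib (fun ω : Ω' => (Ys i ω, fun j => Xs i j ω))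
      (fun ω : Ω => (hY.toLp Y ω, fun j => (hX j).toLp (X j) ω)) P' P := fun i => by
    refine (hident i).trans (IdentDistrib.of_ae_eq (hident i).aemeasurable_snd ?_)
    filter_upwards [haeY, ae_all_iff.2 haeX] with ω h1 h2
    simp only [h1, h2]
  have hlim := MultCorr.tendstoInDistribution_empR2 (X := fun j => (hX j).toLp (X j))
    (Y := hY.toLp Y) (D := fun i ω => (Ys i ω, fun j => Xs i j ω)) hvar' hli hXeps' hYe' hindep
    hident'
  refine ⟨?_, hlim⟩
  rw [MultCorr.limVar_eq_integral_sq hli _ (MultCorr.memLp_scoreVar hXeps' hYe')]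
  exact integral_nonneg fun ω => sq_nonneg _
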